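/- Let $\epsilon\in\{-1,0,1\}$ and $r>0$, with $r\le 1$ if $\epsilon=\pm1$. On the disc $\mathbb D(r)=\{x\in\mathbb R^2:|x|<r\}$ let $$F_\epsilon(x,\xi)=\frac{\sqrt{(r^2-|x|^2)|\xi|^2+\langle x,\xi\rangle^2}}{r^2-|x|^2}+\frac{(1+\epsilon r^2)\langle x,\xi\rangle}{(r^2-|x|^2)(1+\epsilon|x|^2)},\qquad x\in\mathbb D(r),\ \xi\in\mathbb R^2,$$ where $|\cdot|$ and $\langle\cdot,\cdot\rangle$ are the Euclidean norm and inner product (the Funk-Finsler metric on the disc equipped with a Riemannian metric of constant curvature $\epsilon$). Then $F_\epsilon$ is a Finsler metric on $\mathbb D(r)$ and it is projectively flat: each of its geodesics is straight, that is, of the form $\sigma(t)=f(t)a+b$ with constant vectors $a,b\in\mathbb R^2$. For all $x\in\mathbb D(r)$ and $\xi\neq0$ its spray coefficients $G^i=\frac14 g^{il}\{[F_\epsilon^2]_{x^k\xi^l}\xi^k-[F_\epsilon^2]_{x^l}\}$, where $g_{ij}=\frac12[F_\epsilon^2]_{\xi^i\xi^j}$, are $$G^i(x,\xi)=\frac{\xi^i}{r^2-|x|^2}\left(\langle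 x,\xi\rangle+\frac{(1+\epsilon r^2)\left[(1+\epsilon|x|^2)|\xi|^2-2\epsilon\langle x,\xi\rangle^2\right]}{2F_\epsilon(x,\xi)(1+\epsilon|x|^2)^2}\right),\qquad i=1,2,$$ and its $S$-curvature is $$\mathbf S_\epsilon(x,\xi)=\frac{3(1+\epsilon r^2)\left[(1+\epsilon|x|^2)|\xi|^2-2\epsilon\langle x,\xi\rangle^2\right]}{2F_\epsilon(x,\xi)(r^2-|x|^2)(1+\epsilon|x|^2)^2}+\frac{3\langle x,\xi\rangle(1+\epsilon r^2)^2(1-\epsilon|x|^2)}{(r^2-|x|^2)(1-\epsilon^2r^2|x|^2)(1+\epsilon|x|^2)}.$$ Here a geodesic is a curve $\sigma$ in $\mathbb D(r)$, defined on an open interval, with $\dot\sigma\ne0$ and $\ddot\sigma^i+2G^i(\sigma,\dot\sigma)=0$, and $\mathbf S_\epsilon(x,\xi)=\frac{d}{dt}\big|_{t=0}\tau(\gamma(t),\dot\gamma(t))$ for the geodesic $\gamma$ with $\gamma(0)=x$, $\dot\gamma(0)=\xi$, where $\tau(x,\xi)=\ln\frac{\sqrt{\det(g_{ij}(x,\xi))}}{\sigma_{BH}(x)}$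 and $\sigma_{BH}(x)=\mathrm{Vol}(B^2(1))/\mathrm{Vol}\{\xi\in\mathbb R^2: F_\epsilon(x,\xi)<1\}$ is the Busemann-Hausdorff density. -/

import Mathlib

open Set
open scoped ContDiff

noncomputable section

namespace FunkFinsler

/-! Finsler functions on open subsets of `ℝⁿ` are written `F x ξ`, with `x` the base point and
`ξ` the tangent vector, both in standard coordinates. -/

variable {n : ℕ}

/-- The partial derivative `∂f/∂vⁱ` at `v`. -/
def partialDeriv (i : Fin n) (f : EuclideanSpace ℝ (Fin n) → ℝ)
    (v : EuclideanSpace ℝ (Fin n)) : ℝ :=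
  lineDeriv ℝ f v (EuclideanSpace.single i 1)

/-- The fundamental tensor `g_{ij}(x, ξ) = (1/2) ∂²(F²)/∂ξⁱ∂ξʲ`. -/
def fundamentalTensor (F : EuclideanSpace ℝ (Fin n) → EuclideanSpace ℝ (Fin n) → ℝ)
    (x ξ : EuclideanSpace ℝ (Fin n)) : Matrix (Fin n) (Fin n) ℝ :=
  Matrix.of fun i j =>
    (1 / 2) * partialDeriv i (fun η => partialDeriv j (fun ζ => F x ζ ^ 2) η) ξ

/-- `F` is a Finsler metric on the open set `U ⊆ ℝⁿ`. -/
structure IsFinslerOn (F : EuclideanSpace ℝ (Fin n) → EuclideanSpace ℝ (Fin n) → ℝ)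
    (U : Set (EuclideanSpace ℝ (Fin n))) : Prop where
  isOpen : IsOpen U
  nonneg : ∀ x ∈ U, ∀ ξ, 0 ≤ F x ξ
  smooth : ContDiffOn ℝ ∞
    (fun p : EuclideanSpace ℝ (Fin n) × EuclideanSpace ℝ (Fin n) => F p.1 p.2)
    {p | p.1 ∈ U ∧ p.2 ≠ 0}
  homogeneous : ∀ x ∈ U, ∀ ξ, ∀ c : ℝ, 0 < c → F x (c • ξ) = c * F x ξ
  posDef : ∀ x ∈ U, ∀ ξ, ξ ≠ 0 → (fundamentalTensor F x ξ).PosDef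

/-- The spray coefficients
`Gⁱ = (1/4) g^{il} { [F²]_{x^k ξ^l} ξ^k - [F²]_{x^l} }`. -/
def spray (F : EuclideanSpace ℝ (Fin n) → EuclideanSpace ℝ (Fin n) → ℝ)
    (x ξ : EuclideanSpace ℝ (Fin n)) : EuclideanSpace ℝ (Fin n) :=
  WithLp.toLp 2 fun i =>
    (1 / 4) * ∑ l, (fundamentalTensor F x ξ)⁻¹ i l *
      ((∑ k, partialDeriv l (fun η => partialDeriv k (fun y => F y η ^ 2) x) ξ * ξ k)
        - partialDeriv l (fun y => F y ξ ^ 2) x)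

/-- `σ` is a (nonconstant) geodesic of `F` in `U` on the parameter set `I`:
`σ'' + 2 G(σ, σ') = 0` with `σ' ≠ 0` (in particular `σ` is differentiable on `I`). -/
def IsGeodesicOn (F : EuclideanSpace ℝ (Fin n) → EuclideanSpace ℝ (Fin n) → ℝ)
    (U : Set (EuclideanSpace ℝ (Fin n))) (I : Set ℝ)
    (σ : ℝ → EuclideanSpace ℝ (Fin n)) : Prop :=
  ∀ t ∈ I, σ t ∈ U ∧ deriv σ t ≠ 0 ∧
    HasDerivAt (deriv σ) (-((2 : ℝ) • spray F (σ t) (deriv σ t))) t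

/-- `F` is projectively flat on `U`: every geodesic, defined on any open interval, has the form
`σ(t) = f(t) a + b` for constant vectors `a`, `b`. -/
def IsProjectivelyFlatOn (F : EuclideanSpace ℝ (Fin n) → EuclideanSpace ℝ (Fin n) → ℝ)
    (U : Set (EuclideanSpace ℝ (Fin n))) : Prop :=
  ∀ (I : Set ℝ) (σ : ℝ → EuclideanSpace ℝ (Fin n)),
    IsOpen I → I.OrdConnected → IsGeodesicOn F U I σ →
    ∃ (a b : EuclideanSpace ℝ (Fin n)) (f : ℝ → ℝ), ∀ t ∈ I, σ t = f t • a + b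

/-- The density of the Busemann-Hausdorff volume form with respect to Lebesgue measure. -/
def busemannHausdorffDensity (F : EuclideanSpace ℝ (Fin n) → EuclideanSpace ℝ (Fin n) → ℝ)
    (x : EuclideanSpace ℝ (Fin n)) : ℝ :=
  (MeasureTheory.volume (Metric.ball (0 : EuclideanSpace ℝ (Fin n)) 1)).toReal /
    (MeasureTheory.volume {ξ : EuclideanSpace ℝ (Fin n) | F x ξ < 1}).toReal

/-- The distortion `τ = ln (√det(g_{ij}(x, ξ)) / σ_BH(x))`. -/
def distortion (F : EuclideanSpace ℝ (Fin n) → EuclideanSpace ℝ (Fin n) → ℝ)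
    (x ξ : EuclideanSpace ℝ (Fin n)) : ℝ :=
  Real.log (Real.sqrt (fundamentalTensor F x ξ).det / busemannHausdorffDensity F x)

/-- The S-curvature of `F` at `(x, ξ)` is `S`: there is a geodesic `γ` with `γ(0) = x` and
`γ'(0) = ξ`, and for every such geodesic the derivative of `τ(γ(t), γ'(t))` at `t = 0` exists and
equals `S`. -/
def HasSCurvatureAt (F : EuclideanSpace ℝ (Fin n) → EuclideanSpace ℝ (Fin n) → ℝ)
    (U : Set (EuclideanSpace ℝ (Fin n))) (x ξ : EuclideanSpace ℝ (Fin n)) (S : ℝ) : Prop :=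
  (∃ (δ : ℝ) (γ : ℝ → EuclideanSpace ℝ (Fin n)), 0 < δ ∧
      IsGeodesicOn F U (Ioo (-δ) δ) γ ∧ γ 0 = x ∧ deriv γ 0 = ξ) ∧
    ∀ (δ : ℝ) (γ : ℝ → EuclideanSpace ℝ (Fin n)), 0 < δ →
      IsGeodesicOn F U (Ioo (-δ) δ) γ → γ 0 = x → deriv γ 0 = ξ →
      HasDerivAt (fun t => distortion F (γ t) (deriv γ t)) S 0

/-- The Riemannian part `α` of the Funk-Finsler metric on the disc of radius `r`. -/
def funkAlpha (r : ℝ) (x ξ : EuclideanSpace ℝ (Fin 2)) : ℝ :=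
  Real.sqrt ((r ^ 2 - ‖x‖ ^ 2) * ‖ξ‖ ^ 2 + inner ℝ x ξ ^ 2) / (r ^ 2 - ‖x‖ ^ 2)

/-- The 1-form `β` of the Funk-Finsler metric on the disc of radius `r`. -/
def funkBeta (ε r : ℝ) (x ξ : EuclideanSpace ℝ (Fin 2)) : ℝ :=
  (1 + ε * r ^ 2) * inner ℝ x ξ / ((r ^ 2 - ‖x‖ ^ 2) * (1 + ε * ‖x‖ ^ 2))

/-- The Funk-Finsler metric `F_ε = α + β` on the disc of radius `r` centred at the origin, equipped
with a Riemannian metric of constant curvature `ε`. -/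
def funkMetric (ε r : ℝ) (x ξ : EuclideanSpace ℝ (Fin 2)) : ℝ :=
  funkAlpha r x ξ + funkBeta ε r x ξ

end FunkFinsler

end

/-!
The metric `F = α + β` is a Randers metric: `α` is the Klein metric of the disc, whose geodesics are
straight, and `β` is a closed 1-form. Two facts about its first derivatives `funkDeriv` carry the
proof.

*Hamel's equation* (`hamel`). Differentiating `F` along `x` in the direction `ξ` and then along `ξ`
gives back the derivative along `x`. Together with Euler's relation this reduces the right-hand side
of the definition of the spray to a multiple of `g ξ`, so that the spray is `P ξ` with
`2 P F = ∂F/∂xᵏ ξᵏ` (`spray_funkMetric`). The acceleration of a geodesic is then parallel to its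
velocity, which forces it to be straight (`exists_straight_of_hasDerivAt_deriv`). The `F`-speed is
constant along a geodesic, so on a given line geodesics solve a scalar first-order equation, which
gives their existence (`exists_geodesic`).

*Dimension two.* The fundamental tensor is `λ n ⊗ n + dF ⊗ dF`, where `n` is the covector
annihilating `ξ` and `dF(ξ) = F` (`fundamentalTensor_funkMetric`). Hence it is positive definite and
its determinant is `λ F²`, where `λ > 0` is explicit.

For the S-curvature it remains to find the Busemann-Hausdorff density. Since `β` has `α`-norm less
than one, the unit disc of `F` is the interior of an ellipse, whose area is computed by an affine
change of variables (`volume_ellipse`). Up to a constant, the distortion is then a combination of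
logarithms of `F`, of the radicand `W` of `α` and of two functions of `|x|²`
(`distortion_funkMetric`). Along a geodesic `F` is constant and `W' = -4 P W`, which yields the
formula.
-/

namespace FunkFinsler

/-! ### First and second derivatives of the metric -/

/-- The radicand `W = (r² - |x|²) |ξ|² + ⟨x, ξ⟩²` of `funkAlpha`. -/
noncomputable def radicand (r : ℝ) (x ξ : EuclideanSpace ℝ (Fin 2)) : ℝ :=
  (r ^ 2 - ‖x‖ ^ 2) * ‖ξ‖ ^ 2 + inner ℝ x ξ ^ 2

/-- The derivative of `funkMetric ε r` at `(x, ξ)` in the direction `(v, w)`. -/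
noncomputable def funkDeriv (ε r : ℝ) (x ξ v w : EuclideanSpace ℝ (Fin 2)) : ℝ :=
  ((r ^ 2 - ‖x‖ ^ 2) * inner ℝ ξ w - inner ℝ x v * ‖ξ‖ ^ 2 +
      inner ℝ x ξ * (inner ℝ x w + inner ℝ v ξ)) /
      (√(radicand r x ξ) * (r ^ 2 - ‖x‖ ^ 2)) +
    2 * √(radicand r x ξ) * inner ℝ x v / (r ^ 2 - ‖x‖ ^ 2) ^ 2 +
    (1 + ε * r ^ 2) *
      ((inner ℝ x w + inner ℝ v ξ) / ((r ^ 2 - ‖x‖ ^ 2) * (1 + ε * ‖x‖ ^ 2)) +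
        2 * inner ℝ x ξ * inner ℝ x v / ((r ^ 2 - ‖x‖ ^ 2) ^ 2 * (1 + ε * ‖x‖ ^ 2)) -
        2 * ε * inner ℝ x ξ * inner ℝ x v / ((r ^ 2 - ‖x‖ ^ 2) * (1 + ε * ‖x‖ ^ 2) ^ 2))

/-- The derivative of `funkDeriv ε r x ξ v u` with respect to `ξ` in the direction `w`. -/
noncomputable def funkDerivDeriv (ε r : ℝ) (x ξ v u w : EuclideanSpace ℝ (Fin 2)) : ℝ :=
  ((r ^ 2 - ‖x‖ ^ 2) * inner ℝ w u - 2 * inner ℝ x v * inner ℝ ξ w +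
      inner ℝ x w * (inner ℝ x u + inner ℝ v ξ) + inner ℝ x ξ * inner ℝ v w) /
      (√(radicand r x ξ) * (r ^ 2 - ‖x‖ ^ 2)) -
    ((r ^ 2 - ‖x‖ ^ 2) * inner ℝ ξ u - inner ℝ x v * ‖ξ‖ ^ 2 +
      inner ℝ x ξ * (inner ℝ x u + inner ℝ v ξ)) *
      ((r ^ 2 - ‖x‖ ^ 2) * inner ℝ ξ w + inner ℝ x ξ * inner ℝ x w) /
      (√(radicand r x ξ) ^ 3 * (r ^ 2 - ‖x‖ ^ 2)) +
    2 * ((r ^ 2 - ‖x‖ ^ 2) * inner ℝ ξ w + inner ℝ x ξ * inner ℝ x w) * inner ℝ x v /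
      (√(radicand r x ξ) * (r ^ 2 - ‖x‖ ^ 2) ^ 2) +
    (1 + ε * r ^ 2) *
      (inner ℝ v w / ((r ^ 2 - ‖x‖ ^ 2) * (1 + ε * ‖x‖ ^ 2)) +
        2 * inner ℝ x w * inner ℝ x v / ((r ^ 2 - ‖x‖ ^ 2) ^ 2 * (1 + ε * ‖x‖ ^ 2)) -
        2 * ε * inner ℝ x w * inner ℝ x v / ((r ^ 2 - ‖x‖ ^ 2) * (1 + ε * ‖x‖ ^ 2) ^ 2))

lemma funkMetric_eq (ε r : ℝ) (x ξ : EuclideanSpace ℝ (Fin 2)) :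
    funkMetric ε r x ξ = √(radicand r x ξ) / (r ^ 2 - ‖x‖ ^ 2) +
      (1 + ε * r ^ 2) * inner ℝ x ξ / ((r ^ 2 - ‖x‖ ^ 2) * (1 + ε * ‖x‖ ^ 2)) := rfl

lemma hasDerivAt_radicand {r t : ℝ} {X Y : ℝ → EuclideanSpace ℝ (Fin 2)}
    {v w : EuclideanSpace ℝ (Fin 2)} (hX : HasDerivAt X v t) (hY : HasDerivAt Y w t) :
    HasDerivAt (fun s => radicand r (X s) (Y s))
      (2 * ((r ^ 2 - ‖X t‖ ^ 2) * inner ℝ (Y t) w - inner ℝ (X t) v * ‖Y t‖ ^ 2 +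
      inner ℝ (X t) (Y t) * (inner ℝ (X t) w + inner ℝ v (Y t)))) t := by
  have h := ((hX.norm_sq.const_sub (r ^ 2)).mul hY.norm_sq).add ((hX.inner ℝ hY).pow 2)
  refine h.congr_deriv ?_
  simp only [Nat.cast_ofNat]
  ring

lemma hasDerivAt_funkMetric {ε r t : ℝ} {X Y : ℝ → EuclideanSpace ℝ (Fin 2)}
    {v w : EuclideanSpace ℝ (Fin 2)} (hX : HasDerivAt X v t) (hY : HasDerivAt Y w t)
    (hD : r ^ 2 - ‖X t‖ ^ 2 ≠ 0) (hE : 1 + ε * ‖X t‖ ^ 2 ≠ 0)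
    (hW : 0 < radicand r (X t) (Y t)) :
    HasDerivAt (fun s => funkMetric ε r (X s) (Y s)) (funkDeriv ε r (X t) (Y t) v w) t := by
  have hS : √(radicand r (X t) (Y t)) ≠ 0 := (Real.sqrt_pos.2 hW).ne'
  have dD := hX.norm_sq.const_sub (r ^ 2)
  have dE := (hX.norm_sq.const_mul ε).const_add 1
  have h := (((hasDerivAt_radicand (r := r) hX hY).sqrt hW.ne').div dD hD).add
    (((hX.inner ℝ hY).const_mul (1 + ε * r ^ 2)).div (dD.mul dE) (mul_ne_zero hD hE))
  refine (h.congr_of_eventuallyEq (Filter.Eventually.of_forall fun s => ?_)).congr_deriv ?_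
  · exact funkMetric_eq ε r (X s) (Y s)
  · unfold funkDeriv
    simp only [Pi.mul_apply]
    field_simp
    ring

lemma hasDerivAt_funkDeriv {ε r t : ℝ} {Y : ℝ → EuclideanSpace ℝ (Fin 2)}
    {x v u w : EuclideanSpace ℝ (Fin 2)} (hY : HasDerivAt Y w t)
    (hD : r ^ 2 - ‖x‖ ^ 2 ≠ 0) (hW : 0 < radicand r x (Y t)) :
    HasDerivAt (fun s => funkDeriv ε r x (Y s) v u) (funkDerivDeriv ε r x (Y t) v u w) t := by
  have hS : √(radicand r x (Y t)) ≠ 0 := (Real.sqrt_pos.2 hW).ne'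
  have dS := (hasDerivAt_radicand (r := r) (hasDerivAt_const t x) hY).sqrt hW.ne'
  have dI (z : EuclideanSpace ℝ (Fin 2)) : HasDerivAt (fun s => inner ℝ z (Y s)) (inner ℝ z w) t := by
    simpa using (hasDerivAt_const t z).inner ℝ hY
  have dIu : HasDerivAt (fun s => inner ℝ (Y s) u) (inner ℝ w u) t := by
    simpa using hY.inner ℝ (hasDerivAt_const t u)
  have h := (((((dIu.const_mul (r ^ 2 - ‖x‖ ^ 2)).sub (hY.norm_sq.const_mul (inner ℝ x v))).add
    ((dI x).mul ((dI v).const_add (inner ℝ x u)))).div (dS.mul_const (r ^ 2 - ‖x‖ ^ 2))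
      (mul_ne_zero hS hD)).add
    (((dS.const_mul 2).mul_const (inner ℝ x v)).div_const ((r ^ 2 - ‖x‖ ^ 2) ^ 2))).add
    (((((dI v).const_add (inner ℝ x u)).div_const ((r ^ 2 - ‖x‖ ^ 2) * (1 + ε * ‖x‖ ^ 2))).add
      ((((dI x).const_mul 2).mul_const (inner ℝ x v)).div_const
        ((r ^ 2 - ‖x‖ ^ 2) ^ 2 * (1 + ε * ‖x‖ ^ 2)))).sub
      ((((dI x).const_mul (2 * ε)).mul_const (inner ℝ x v)).div_const
        ((r ^ 2 - ‖x‖ ^ 2) * (1 + ε * ‖x‖ ^ 2) ^ 2)) |>.const_mul (1 + ε * r ^ 2))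
  refine h.congr_deriv ?_
  unfold funkDerivDeriv
  simp only [Pi.mul_apply, Pi.add_apply, Pi.sub_apply, inner_zero_left, inner_zero_right]
  field_simp
  ring

/-! ### Positivity -/

/-- The factors occurring in the denominators are positive on the disc; this is the only place where
`r ≤ 1` is needed. -/
lemma pos_factors_of_mem_ball {ε r : ℝ} (hε : ε = -1 ∨ ε = 0 ∨ ε = 1) (hr : 0 < r)
    (hr1 : ε ≠ 0 → r ≤ 1) {x : EuclideanSpace ℝ (Fin 2)} (hx : x ∈ Metric.ball 0 r) :
    0 < r ^ 2 - ‖x‖ ^ 2 ∧ 0 < 1 + ε * ‖x‖ ^ 2 ∧ 0 < 1 - ε ^ 2 * r ^ 2 * ‖x‖ ^ 2 := by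
  have hx' : ‖x‖ < r := by simpa using hx
  have h0 := norm_nonneg x
  have hD : ‖x‖ ^ 2 < r ^ 2 := by gcongr
  refine ⟨by linarith, ?_⟩
  rcases hε with rfl | rfl | rfl
  · have h1 := hr1 (by norm_num)
    have : r ^ 2 ≤ 1 := pow_le_one₀ hr.le h1
    constructor <;> nlinarith [sq_nonneg ‖x‖]
  · norm_num
  · have h1 := hr1 (by norm_num)
    have : r ^ 2 ≤ 1 := pow_le_one₀ hr.le h1
    constructor <;> nlinarith [sq_nonneg ‖x‖]

lemma radicand_pos {r : ℝ} {x ξ : EuclideanSpace ℝ (Fin 2)} (hD : 0 < r ^ 2 - ‖x‖ ^ 2)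
    (hξ : ξ ≠ 0) : 0 < radicand r x ξ := by
  have := norm_pos_iff.2 hξ
  unfold radicand
  positivity

/-- The 1-form `funkBeta` has norm less than one with respect to `funkAlpha`: both sides are
multiplied by `(r² - |x|²)²`. -/
lemma sq_beta_lt_radicand {ε r : ℝ} {x ξ : EuclideanSpace ℝ (Fin 2)} (hD : 0 < r ^ 2 - ‖x‖ ^ 2)
    (hE : 0 < 1 + ε * ‖x‖ ^ 2) (hC : 0 < 1 - ε ^ 2 * r ^ 2 * ‖x‖ ^ 2) (hξ : ξ ≠ 0) :
    ((1 + ε * r ^ 2) * inner ℝ x ξ / (1 + ε * ‖x‖ ^ 2)) ^ 2 < radicand r x ξ := by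
  have hs : 0 < ‖ξ‖ ^ 2 := by have := norm_pos_iff.2 hξ; positivity
  have hq : inner ℝ x ξ ^ 2 ≤ ‖x‖ ^ 2 * ‖ξ‖ ^ 2 := by
    rw [← mul_pow]; exact sq_le_sq' (by linarith [neg_le_of_abs_le (abs_real_inner_le_norm x ξ)])
      (real_inner_le_norm x ξ)
  rw [div_pow, div_lt_iff₀ (by positivity)]
  unfold radicand
  set ρ := ‖x‖ ^ 2
  set s := ‖ξ‖ ^ 2
  set q : ℝ := inner ℝ x ξ
  -- The difference of the two sides is `r² - ρ` times the following expression. It is linear in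
  -- `q²`, where `0 ≤ q² ≤ ρ s`, and equals `(1 - ε² r² ρ) s` at the upper end.
  have key : 0 < (1 + ε * ρ) ^ 2 * s - ε * (2 + ε * (ρ + r ^ 2)) * q ^ 2 := by
    rcases le_total (ε * (2 + ε * (ρ + r ^ 2))) 0 with h | h
    · have : 0 < (1 + ε * ρ) ^ 2 * s := by positivity
      nlinarith [mul_nonneg (neg_nonneg.2 h) (sq_nonneg q)]
    · nlinarith [mul_nonneg h (sub_nonneg.2 hq), mul_pos hC hs]
  nlinarith [mul_pos hD key]

lemma funkMetric_pos {ε r : ℝ} {x ξ : EuclideanSpace ℝ (Fin 2)} (hD : 0 < r ^ 2 - ‖x‖ ^ 2)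
    (hE : 0 < 1 + ε * ‖x‖ ^ 2) (hC : 0 < 1 - ε ^ 2 * r ^ 2 * ‖x‖ ^ 2) (hξ : ξ ≠ 0) :
    0 < funkMetric ε r x ξ := by
  have h := Real.neg_sqrt_lt_of_sq_lt (sq_beta_lt_radicand hD hE hC hξ)
  have : funkMetric ε r x ξ = (√(radicand r x ξ) +
      (1 + ε * r ^ 2) * inner ℝ x ξ / (1 + ε * ‖x‖ ^ 2)) / (r ^ 2 - ‖x‖ ^ 2) := by
    rw [funkMetric_eq]; field_simp
  rw [this]
  exact div_pos (by linarith) hD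

lemma funkMetric_zero (ε r : ℝ) (x : EuclideanSpace ℝ (Fin 2)) : funkMetric ε r x 0 = 0 := by
  simp [funkMetric_eq, radicand]

lemma funkMetric_smul (ε r : ℝ) (x ξ : EuclideanSpace ℝ (Fin 2)) {c : ℝ} (hc : 0 ≤ c) :
    funkMetric ε r x (c • ξ) = c * funkMetric ε r x ξ := by
  have : radicand r x (c • ξ) = c ^ 2 * radicand r x ξ := by
    simp only [radicand, norm_smul, inner_smul_right, Real.norm_eq_abs, mul_pow, sq_abs]; ring
  rw [funkMetric_eq, funkMetric_eq, this, Real.sqrt_mul (sq_nonneg c), Real.sqrt_sq hc,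
    inner_smul_right]
  ring

/-! ### Smoothness -/

lemma contDiffAt_funkMetric {ε r : ℝ} {p : EuclideanSpace ℝ (Fin 2) × EuclideanSpace ℝ (Fin 2)}
    (hD : r ^ 2 - ‖p.1‖ ^ 2 ≠ 0) (hE : 1 + ε * ‖p.1‖ ^ 2 ≠ 0) (hW : 0 < radicand r p.1 p.2) :
    ContDiffAt ℝ ∞ (fun p : EuclideanSpace ℝ (Fin 2) × EuclideanSpace ℝ (Fin 2) =>
      funkMetric ε r p.1 p.2) p := by
  have h1 : ContDiffAt ℝ ∞ (fun p : EuclideanSpace ℝ (Fin 2) × EuclideanSpace ℝ (Fin 2) =>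
      ‖p.1‖ ^ 2) p := contDiffAt_fst.norm_sq ℝ
  have h2 : ContDiffAt ℝ ∞ (fun p : EuclideanSpace ℝ (Fin 2) × EuclideanSpace ℝ (Fin 2) =>
      ‖p.2‖ ^ 2) p := contDiffAt_snd.norm_sq ℝ
  have h3 : ContDiffAt ℝ ∞ (fun p : EuclideanSpace ℝ (Fin 2) × EuclideanSpace ℝ (Fin 2) =>
      (inner ℝ p.1 p.2 : ℝ)) p := contDiffAt_fst.inner ℝ contDiffAt_snd
  have hd := (contDiffAt_const (c := r ^ 2)).sub h1
  have he := (contDiffAt_const (c := (1 : ℝ))).add ((contDiffAt_const (c := ε)).mul h1)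
  exact ((((hd.mul h2).add (h3.pow 2)).sqrt hW.ne').div hd hD).add
    (((contDiffAt_const (c := 1 + ε * r ^ 2)).mul h3).div (hd.mul he) (mul_ne_zero hD hE))

/-! ### The fundamental tensor -/

lemma partialDeriv_eq_of_hasDerivAt {i : Fin 2} {f : EuclideanSpace ℝ (Fin 2) → ℝ}
    {v : EuclideanSpace ℝ (Fin 2)} {f' : ℝ}
    (h : HasDerivAt (fun t : ℝ => f (v + t • EuclideanSpace.single i 1)) f' 0) :
    partialDeriv i f v = f' := h.deriv

lemma hasDerivAt_line (v w : EuclideanSpace ℝ (Fin 2)) (t : ℝ) :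
    HasDerivAt (fun s : ℝ => v + s • w) w t := by
  simpa using ((hasDerivAt_id t).smul_const w).const_add v

variable {ε r : ℝ} {x ξ : EuclideanSpace ℝ (Fin 2)}

lemma partialDeriv_sq_fiber (hD : 0 < r ^ 2 - ‖x‖ ^ 2) (hE : 0 < 1 + ε * ‖x‖ ^ 2) (hξ : ξ ≠ 0)
    (j : Fin 2) :
    partialDeriv j (fun ζ => funkMetric ε r x ζ ^ 2) ξ =
      2 * funkMetric ε r x ξ * funkDeriv ε r x ξ 0 (EuclideanSpace.single j 1) := by
  refine partialDeriv_eq_of_hasDerivAt ?_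
  have := (hasDerivAt_funkMetric (ε := ε) (r := r) (hasDerivAt_const (0 : ℝ) x)
    (hasDerivAt_line ξ (EuclideanSpace.single j 1) 0) hD.ne' hE.ne'
    (by simpa using radicand_pos hD hξ)).pow 2
  refine this.congr_deriv ?_
  simp

lemma partialDeriv_sq_base (hD : 0 < r ^ 2 - ‖x‖ ^ 2) (hE : 0 < 1 + ε * ‖x‖ ^ 2) (hξ : ξ ≠ 0)
    (k : Fin 2) :
    partialDeriv k (fun y => funkMetric ε r y ξ ^ 2) x =
      2 * funkMetric ε r x ξ * funkDeriv ε r x ξ (EuclideanSpace.single k 1) 0 := by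
  refine partialDeriv_eq_of_hasDerivAt ?_
  have := (hasDerivAt_funkMetric (ε := ε) (r := r)
    (hasDerivAt_line x (EuclideanSpace.single k 1) 0) (hasDerivAt_const (0 : ℝ) ξ)
    (by simpa using hD.ne') (by simpa using hE.ne') (by simpa using radicand_pos hD hξ)).pow 2
  refine this.congr_deriv ?_
  simp

/-- The derivative along the fibre of `2 F dF(v, u)`, that is, of a first derivative of `F²`. The
function `f` need only agree with it at nonzero vectors, where `F` is differentiable. -/
lemma partialDeriv_mul_funkDeriv (hD : 0 < r ^ 2 - ‖x‖ ^ 2) (hE : 0 < 1 + ε * ‖x‖ ^ 2)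
    (hξ : ξ ≠ 0) (v u : EuclideanSpace ℝ (Fin 2)) (l : Fin 2)
    {f : EuclideanSpace ℝ (Fin 2) → ℝ}
    (hf : ∀ η ≠ 0, f η = 2 * funkMetric ε r x η * funkDeriv ε r x η v u) :
    partialDeriv l f ξ = 2 * (funkDeriv ε r x ξ 0 (EuclideanSpace.single l 1) *
        funkDeriv ε r x ξ v u +
      funkMetric ε r x ξ * funkDerivDeriv ε r x ξ v u (EuclideanSpace.single l 1)) := by
  have hev : f =ᶠ[nhds ξ] fun η => 2 * funkMetric ε r x η * funkDeriv ε r x η v u :=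
    (isOpen_ne.mem_nhds hξ : {η | η ≠ 0} ∈ nhds ξ) |> Filter.mem_of_superset <| hf
  unfold partialDeriv
  rw [hev.lineDeriv_eq]
  refine partialDeriv_eq_of_hasDerivAt ?_
  have hW : 0 < radicand r x (ξ + (0 : ℝ) • EuclideanSpace.single l 1) := by
    simpa using radicand_pos hD hξ
  have := ((hasDerivAt_funkMetric (ε := ε) (r := r) (hasDerivAt_const (0 : ℝ) x)
    (hasDerivAt_line ξ (EuclideanSpace.single l 1) 0) hD.ne' hE.ne' hW).const_mul 2).mul
    (hasDerivAt_funkDeriv (ε := ε) (v := v) (u := u)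
      (hasDerivAt_line ξ (EuclideanSpace.single l 1) 0) hD.ne' hW)
  refine this.congr_deriv ?_
  simp
  ring

/-- The coefficient `λ` of `n ⊗ n` in the fundamental tensor, where `n = (-ξ¹, ξ⁰)`. -/
noncomputable def tensorCoeff (ε r : ℝ) (x ξ : EuclideanSpace ℝ (Fin 2)) : ℝ :=
  funkMetric ε r x ξ * r ^ 2 / √(radicand r x ξ) ^ 3

lemma inner_eq (x y : EuclideanSpace ℝ (Fin 2)) : inner ℝ x y = x 0 * y 0 + x 1 * y 1 := by
  simp [PiLp.inner_apply, Fin.sum_univ_two, mul_comm]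

lemma norm_sq_eq (x : EuclideanSpace ℝ (Fin 2)) : ‖x‖ ^ 2 = x 0 ^ 2 + x 1 ^ 2 := by
  simp [EuclideanSpace.norm_sq_eq, Fin.sum_univ_two]

/-- In dimension two the Hessian of `F` along the fibre is a multiple of `n ⊗ n`, where
`n = (-ξ¹, ξ⁰)`. -/
lemma funkDerivDeriv_fiber (hD : 0 < r ^ 2 - ‖x‖ ^ 2) (hξ : ξ ≠ 0)
    (u w : EuclideanSpace ℝ (Fin 2)) :
    funkDerivDeriv ε r x ξ 0 u w =
      r ^ 2 / √(radicand r x ξ) ^ 3 * ((ξ 0 * u 1 - ξ 1 * u 0) * (ξ 0 * w 1 - ξ 1 * w 0)) := by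
  have hW := radicand_pos hD hξ
  have hS := Real.sqrt_pos.2 hW
  have hS2 := Real.sq_sqrt hW.le
  unfold funkDerivDeriv
  simp only [inner_zero_left, inner_zero_right]
  set S := √(radicand r x ξ)
  unfold radicand at hS2
  have hD' := hD.ne'
  set D := r ^ 2 - ‖x‖ ^ 2 with hDdef
  have hr2 : r ^ 2 = D + (x 0 ^ 2 + x 1 ^ 2) := by rw [hDdef, norm_sq_eq]; ring
  rw [hr2]
  simp only [inner_eq, norm_sq_eq] at hS2 ⊢
  field_simp
  rw [hS2]
  ring

lemma fundamentalTensor_funkMetric (hD : 0 < r ^ 2 - ‖x‖ ^ 2) (hE : 0 < 1 + ε * ‖x‖ ^ 2)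
    (hξ : ξ ≠ 0) :
    fundamentalTensor (funkMetric ε r) x ξ =
      tensorCoeff ε r x ξ • Matrix.vecMulVec ![-ξ 1, ξ 0] ![-ξ 1, ξ 0] +
      Matrix.vecMulVec (fun i => funkDeriv ε r x ξ 0 (EuclideanSpace.single i 1))
        (fun i => funkDeriv ε r x ξ 0 (EuclideanSpace.single i 1)) := by
  ext i j
  rw [fundamentalTensor, Matrix.of_apply,
    partialDeriv_mul_funkDeriv hD hE hξ 0 (EuclideanSpace.single j 1) i
      (fun η hη => partialDeriv_sq_fiber hD hE hη j), funkDerivDeriv_fiber hD hξ]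
  simp only [Matrix.add_apply, Matrix.smul_apply, Matrix.vecMulVec_apply, smul_eq_mul, tensorCoeff]
  fin_cases i <;> fin_cases j <;> simp <;> ring

/-- Euler relation: `F` is homogeneous of degree one in `ξ`. -/
lemma funkDeriv_self (hD : 0 < r ^ 2 - ‖x‖ ^ 2) (hE : 0 < 1 + ε * ‖x‖ ^ 2) (hξ : ξ ≠ 0) :
    funkDeriv ε r x ξ 0 ξ = funkMetric ε r x ξ := by
  have hW := radicand_pos hD hξ
  have hS := Real.sqrt_pos.2 hW
  have hS2 := Real.sq_sqrt hW.le
  have hs : ‖ξ‖ ^ 2 = (√(radicand r x ξ) ^ 2 - inner ℝ x ξ ^ 2) / (r ^ 2 - ‖x‖ ^ 2) := by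
    rw [hS2, radicand]; field_simp; ring
  rw [funkMetric_eq, funkDeriv]
  simp only [inner_zero_left, inner_zero_right, real_inner_self_eq_norm_sq]
  rw [hs]
  generalize 1 + ε * ‖x‖ ^ 2 = E at hE
  generalize r ^ 2 - ‖x‖ ^ 2 = D at hD
  field_simp
  ring

lemma funkDeriv_fiber (v : EuclideanSpace ℝ (Fin 2)) :
    funkDeriv ε r x ξ 0 v = funkDeriv ε r x ξ 0 (EuclideanSpace.single 0 1) * v 0 +
      funkDeriv ε r x ξ 0 (EuclideanSpace.single 1 1) * v 1 := by
  unfold funkDeriv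
  simp only [inner_zero_left, inner_zero_right, inner_eq]
  simp
  ring

lemma funkDeriv_single_euler (hD : 0 < r ^ 2 - ‖x‖ ^ 2) (hE : 0 < 1 + ε * ‖x‖ ^ 2) (hξ : ξ ≠ 0) :
    funkDeriv ε r x ξ 0 (EuclideanSpace.single 0 1) * ξ 0 +
      funkDeriv ε r x ξ 0 (EuclideanSpace.single 1 1) * ξ 1 = funkMetric ε r x ξ := by
  rw [← funkDeriv_fiber, funkDeriv_self hD hE hξ]

lemma det_fundamentalTensor (hD : 0 < r ^ 2 - ‖x‖ ^ 2) (hE : 0 < 1 + ε * ‖x‖ ^ 2) (hξ : ξ ≠ 0) :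
    (fundamentalTensor (funkMetric ε r) x ξ).det =
      funkMetric ε r x ξ ^ 3 * r ^ 2 / √(radicand r x ξ) ^ 3 := by
  have h : (fundamentalTensor (funkMetric ε r) x ξ).det =
      tensorCoeff ε r x ξ * (funkDeriv ε r x ξ 0 (EuclideanSpace.single 0 1) * ξ 0 +
      funkDeriv ε r x ξ 0 (EuclideanSpace.single 1 1) * ξ 1) ^ 2 := by
    rw [fundamentalTensor_funkMetric hD hE hξ, Matrix.det_fin_two]
    simp [Matrix.vecMulVec_apply]
    ring
  rw [h, funkDeriv_single_euler hD hE hξ, tensorCoeff]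
  ring

lemma radius_ne_zero (hD : 0 < r ^ 2 - ‖x‖ ^ 2) : r ≠ 0 := by
  rintro rfl
  nlinarith [sq_nonneg ‖x‖]

lemma posDef_fundamentalTensor (hD : 0 < r ^ 2 - ‖x‖ ^ 2) (hE : 0 < 1 + ε * ‖x‖ ^ 2)
    (hC : 0 < 1 - ε ^ 2 * r ^ 2 * ‖x‖ ^ 2) (hξ : ξ ≠ 0) :
    (fundamentalTensor (funkMetric ε r) x ξ).PosDef := by
  have hF := funkMetric_pos hD hE hC hξ
  have hr := radius_ne_zero hD
  have hW := Real.sqrt_pos.2 (radicand_pos hD hξ)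
  have hc : 0 < tensorCoeff ε r x ξ := by unfold tensorCoeff; positivity
  have heul := funkDeriv_single_euler hD hE hξ
  rw [fundamentalTensor_funkMetric hD hE hξ, Matrix.posDef_iff_dotProduct_mulVec]
  set p : Fin 2 → ℝ := fun i => funkDeriv ε r x ξ 0 (EuclideanSpace.single i 1)
  change p 0 * ξ 0 + p 1 * ξ 1 = _ at heul
  constructor
  · ext i j
    simp only [Matrix.conjTranspose_apply, Matrix.add_apply, Matrix.smul_apply,
      Matrix.vecMulVec_apply, smul_eq_mul, star_trivial]
    ring
  · intro v hv
    have hval : star v ⬝ᵥ ((tensorCoeff ε r x ξ • Matrix.vecMulVec ![-ξ 1, ξ 0] ![-ξ 1, ξ 0] +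
        Matrix.vecMulVec p p).mulVec v) =
        tensorCoeff ε r x ξ * (ξ 0 * v 1 - ξ 1 * v 0) ^ 2 + (p 0 * v 0 + p 1 * v 1) ^ 2 := by
      simp [Matrix.mulVec, dotProduct, Fin.sum_univ_two, Matrix.vecMulVec_apply]
      ring
    rw [hval]
    have h1 : 0 ≤ tensorCoeff ε r x ξ * (ξ 0 * v 1 - ξ 1 * v 0) ^ 2 := by positivity
    have h2 := sq_nonneg (p 0 * v 0 + p 1 * v 1)
    refine lt_of_le_of_ne (add_nonneg h1 h2) fun h0 => hv ?_
    have e1 : ξ 0 * v 1 - ξ 1 * v 0 = 0 := by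
      have : tensorCoeff ε r x ξ * (ξ 0 * v 1 - ξ 1 * v 0) ^ 2 = 0 := by linarith
      simpa [hc.ne'] using this
    have e2 : p 0 * v 0 + p 1 * v 1 = 0 := by
      have : (p 0 * v 0 + p 1 * v 1) ^ 2 = 0 := by linarith
      simpa using this
    -- `v` is both parallel to `ξ` and annihilated by `dF`, while `dF(ξ) = F > 0`.
    have f0 : funkMetric ε r x ξ * v 0 = 0 := by
      rw [← heul]; linear_combination ξ 0 * e2 - p 1 * e1
    have f1 : funkMetric ε r x ξ * v 1 = 0 := by
      rw [← heul]; linear_combination ξ 1 * e2 + p 0 * e1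
    ext i
    fin_cases i
    · simpa [hF.ne'] using f0
    · simpa [hF.ne'] using f1

/-! ### The spray -/

/-- The projective factor of the spray of `funkMetric ε r`. -/
noncomputable def projFactor (ε r : ℝ) (x ξ : EuclideanSpace ℝ (Fin 2)) : ℝ :=
  (inner ℝ x ξ + (1 + ε * r ^ 2) * ((1 + ε * ‖x‖ ^ 2) * ‖ξ‖ ^ 2 - 2 * ε * inner ℝ x ξ ^ 2) /
    (2 * funkMetric ε r x ξ * (1 + ε * ‖x‖ ^ 2) ^ 2)) / (r ^ 2 - ‖x‖ ^ 2)

/-- Hamel's equation `∂²F/∂xᵏ∂ξˡ ξᵏ = ∂F/∂xˡ`, which characterises the metrics whose geodesics are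
straight. -/
lemma hamel (hD : 0 < r ^ 2 - ‖x‖ ^ 2) (hE : 0 < 1 + ε * ‖x‖ ^ 2) (hξ : ξ ≠ 0)
    (w : EuclideanSpace ℝ (Fin 2)) :
    funkDerivDeriv ε r x ξ ξ 0 w = funkDeriv ε r x ξ w 0 := by
  have hW := radicand_pos hD hξ
  have hS := Real.sqrt_pos.2 hW
  have hS2 := Real.sq_sqrt hW.le
  have hs : ‖ξ‖ ^ 2 = (√(radicand r x ξ) ^ 2 - inner ℝ x ξ ^ 2) / (r ^ 2 - ‖x‖ ^ 2) := by
    rw [hS2, radicand]; field_simp; ring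
  unfold funkDerivDeriv funkDeriv
  simp only [inner_zero_right, real_inner_self_eq_norm_sq, real_inner_comm ξ w]
  rw [hs]
  generalize 1 + ε * ‖x‖ ^ 2 = E at hE
  generalize r ^ 2 - ‖x‖ ^ 2 = D at hD
  field_simp
  ring

/-- The projective factor `P` satisfies `2 P F = ∂F/∂xᵏ ξᵏ`. -/
lemma funkDeriv_base_self (hD : 0 < r ^ 2 - ‖x‖ ^ 2) (hE : 0 < 1 + ε * ‖x‖ ^ 2)
    (hC : 0 < 1 - ε ^ 2 * r ^ 2 * ‖x‖ ^ 2) (hξ : ξ ≠ 0) :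
    funkDeriv ε r x ξ ξ 0 = 2 * projFactor ε r x ξ * funkMetric ε r x ξ := by
  have hF := funkMetric_pos hD hE hC hξ
  have hS := Real.sqrt_pos.2 (radicand_pos hD hξ)
  have h : 2 * projFactor ε r x ξ * funkMetric ε r x ξ =
      (2 * inner ℝ x ξ * funkMetric ε r x ξ +
        (1 + ε * r ^ 2) * ((1 + ε * ‖x‖ ^ 2) * ‖ξ‖ ^ 2 - 2 * ε * inner ℝ x ξ ^ 2) /
        (1 + ε * ‖x‖ ^ 2) ^ 2) / (r ^ 2 - ‖x‖ ^ 2) := by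
    unfold projFactor; field_simp
  rw [h, funkMetric_eq]
  unfold funkDeriv
  simp only [inner_zero_right, real_inner_self_eq_norm_sq]
  generalize 1 + ε * ‖x‖ ^ 2 = E at hE
  generalize r ^ 2 - ‖x‖ ^ 2 = D at hD
  field_simp
  ring

/-- By Hamel's equation the bracket in the definition of the spray is `4 P F ∂F/∂ξˡ`, which is
`4 P g ξ`. -/
lemma spray_funkMetric (hD : 0 < r ^ 2 - ‖x‖ ^ 2) (hE : 0 < 1 + ε * ‖x‖ ^ 2)
    (hC : 0 < 1 - ε ^ 2 * r ^ 2 * ‖x‖ ^ 2) (hξ : ξ ≠ 0) :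
    spray (funkMetric ε r) x ξ = projFactor ε r x ξ • ξ := by
  have hdet : IsUnit (fundamentalTensor (funkMetric ε r) x ξ).det :=
    ((posDef_fundamentalTensor hD hE hC hξ).det_pos.ne').isUnit
  have heul := funkDeriv_single_euler hD hE hξ
  have hN (l : Fin 2) : (∑ k, partialDeriv l (fun η =>
        partialDeriv k (fun y => funkMetric ε r y η ^ 2) x) ξ * ξ k)
        - partialDeriv l (fun y => funkMetric ε r y ξ ^ 2) x =
      (fundamentalTensor (funkMetric ε r) x ξ).mulVec (fun i => 4 * projFactor ε r x ξ * ξ i) l := by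
    have hk (k : Fin 2) := partialDeriv_mul_funkDeriv hD hE hξ (EuclideanSpace.single k 1) 0 l
      (fun η hη => partialDeriv_sq_base hD hE hη k)
    have hlin1 : funkDeriv ε r x ξ ξ 0 = funkDeriv ε r x ξ (EuclideanSpace.single 0 1) 0 * ξ 0 +
        funkDeriv ε r x ξ (EuclideanSpace.single 1 1) 0 * ξ 1 := by
      unfold funkDeriv
      simp only [inner_zero_right, inner_eq]
      simp
      ring
    have hlin2 (w : EuclideanSpace ℝ (Fin 2)) : funkDerivDeriv ε r x ξ ξ 0 w =
        funkDerivDeriv ε r x ξ (EuclideanSpace.single 0 1) 0 w * ξ 0 +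
        funkDerivDeriv ε r x ξ (EuclideanSpace.single 1 1) 0 w * ξ 1 := by
      unfold funkDerivDeriv
      simp only [inner_zero_right, inner_eq]
      simp
      ring
    have hg : (fundamentalTensor (funkMetric ε r) x ξ).mulVec
        (fun i => 4 * projFactor ε r x ξ * ξ i) l =
        4 * projFactor ε r x ξ * (funkDeriv ε r x ξ 0 (EuclideanSpace.single l 1) *
          funkMetric ε r x ξ) := by
      rw [fundamentalTensor_funkMetric hD hE hξ, ← heul]
      fin_cases l <;>
        simp [Matrix.mulVec, dotProduct, Fin.sum_univ_two, Matrix.vecMulVec_apply] <;> ring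
    rw [hg, Fin.sum_univ_two, hk, hk, partialDeriv_sq_base hD hE hξ]
    have h1 := hamel hD hE hξ (EuclideanSpace.single l 1)
    rw [hlin2] at h1
    have h2 := funkDeriv_base_self hD hE hC hξ
    rw [hlin1] at h2
    linear_combination 2 * funkMetric ε r x ξ * h1 +
      2 * funkDeriv ε r x ξ 0 (EuclideanSpace.single l 1) * h2
  ext i
  have hinv : (fundamentalTensor (funkMetric ε r) x ξ)⁻¹.mulVec
      ((fundamentalTensor (funkMetric ε r) x ξ).mulVec fun i => 4 * projFactor ε r x ξ * ξ i) i =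
      4 * projFactor ε r x ξ * ξ i := by
    rw [Matrix.mulVec_mulVec, Matrix.nonsing_inv_mul _ hdet, Matrix.one_mulVec]
  simp only [spray, hN, PiLp.smul_apply, smul_eq_mul]
  change 1 / 4 * (fundamentalTensor (funkMetric ε r) x ξ)⁻¹.mulVec
    ((fundamentalTensor (funkMetric ε r) x ξ).mulVec fun i => 4 * projFactor ε r x ξ * ξ i) i = _
  rw [hinv]
  ring

/-! ### Straight geodesics -/

/-- A curve whose acceleration is a multiple of its velocity is straight. The unit tangent vector is
a constant `a`, and hence so is `σ - ⟨a, σ⟩ a`. -/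
lemma exists_straight_of_hasDerivAt_deriv {E : Type*} [NormedAddCommGroup E]
    [InnerProductSpace ℝ E] {I : Set ℝ} {σ : ℝ → E}
    (hI : IsOpen I) (hI' : I.OrdConnected) {c : ℝ → ℝ} (hne : ∀ t ∈ I, deriv σ t ≠ 0)
    (hacc : ∀ t ∈ I, HasDerivAt (deriv σ) (c t • deriv σ t) t) :
    ∃ (a b : E) (f : ℝ → ℝ), ∀ t ∈ I, σ t = f t • a + b := by
  have hpre : IsPreconnected I := hI'.isPreconnected
  have hdir (t : ℝ) (ht : t ∈ I) :
      -- The norm is written as a square root, to be differentiated as one.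
      HasDerivAt (fun s => (√(‖deriv σ s‖ ^ 2))⁻¹ • deriv σ s) 0 t := by
    have hn := norm_pos_iff.2 (hne t ht)
    have hn2 : 0 < ‖deriv σ t‖ ^ 2 := by positivity
    have h := (((hacc t ht).norm_sq.sqrt hn2.ne').inv (Real.sqrt_pos.2 hn2).ne').smul (hacc t ht)
    refine h.congr_deriv ?_
    rw [Pi.inv_apply, smul_smul, ← add_smul, inner_smul_right, real_inner_self_eq_norm_sq,
      Real.sqrt_sq hn.le]
    convert zero_smul ℝ (deriv σ t)
    field_simp
    ring
  obtain ⟨a, ha⟩ := hI.exists_is_const_of_deriv_eq_zero hpre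
    (fun t ht => (hdir t ht).differentiableAt.differentiableWithinAt)
    (fun t ht => (hdir t ht).deriv)
  have hvel (t : ℝ) (ht : t ∈ I) : deriv σ t = ‖deriv σ t‖ • a ∧ ‖a‖ = 1 := by
    have hn := norm_pos_iff.2 (hne t ht)
    rw [← ha t ht, Real.sqrt_sq hn.le, smul_smul, mul_inv_cancel₀ hn.ne', one_smul]
    exact ⟨rfl, by rw [norm_smul, norm_inv, norm_norm, inv_mul_cancel₀ hn.ne']⟩
  have hperp (t : ℝ) (ht : t ∈ I) : HasDerivAt (fun s => σ s - inner ℝ a (σ s) • a) 0 t := by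
    have hσ : HasDerivAt σ (deriv σ t) t :=
      (differentiableAt_of_deriv_ne_zero (hne t ht)).hasDerivAt
    have h := hσ.sub (((hasDerivAt_const t a).inner ℝ hσ).smul_const a)
    refine h.congr_deriv ?_
    obtain ⟨h1, h2⟩ := hvel t ht
    rw [h1, inner_smul_right, real_inner_self_eq_norm_sq, h2]
    simp
  obtain ⟨b, hb⟩ := hI.exists_is_const_of_deriv_eq_zero hpre
    (fun t ht => (hperp t ht).differentiableAt.differentiableWithinAt)
    (fun t ht => (hperp t ht).deriv)
  exact ⟨a, b, fun t => inner ℝ a (σ t), fun t ht => by rw [← hb t ht]; abel⟩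

/-- `F` is constant along the curves with acceleration `-2Pγ'`, where `P` is the projective
factor. -/
lemma hasDerivAt_funkMetric_of_geodesic {X Y : ℝ → EuclideanSpace ℝ (Fin 2)} {t : ℝ}
    (hX : HasDerivAt X (Y t) t)
    (hY : HasDerivAt Y (-((2 : ℝ) • projFactor ε r (X t) (Y t) • Y t)) t)
    (hD : 0 < r ^ 2 - ‖X t‖ ^ 2) (hE : 0 < 1 + ε * ‖X t‖ ^ 2)
    (hC : 0 < 1 - ε ^ 2 * r ^ 2 * ‖X t‖ ^ 2) (hne : Y t ≠ 0) :
    HasDerivAt (fun s => funkMetric ε r (X s) (Y s)) 0 t := by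
  refine (hasDerivAt_funkMetric hX hY hD.ne' hE.ne' (radicand_pos hD hne)).congr_deriv ?_
  have hlin (v : EuclideanSpace ℝ (Fin 2)) (c : ℝ) : funkDeriv ε r (X t) (Y t) v (-(c • Y t)) =
      funkDeriv ε r (X t) (Y t) v 0 - c * funkDeriv ε r (X t) (Y t) 0 (Y t) := by
    unfold funkDeriv
    simp only [inner_neg_right, inner_smul_right, inner_zero_right, inner_zero_left]
    ring
  rw [smul_smul, hlin, funkDeriv_base_self hD hE hC hne, funkDeriv_self hD hE hne]
  ring

lemma hasDerivAt_radicand_of_geodesic {X Y : ℝ → EuclideanSpace ℝ (Fin 2)} {t : ℝ} {c : ℝ}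
    (hX : HasDerivAt X (Y t) t)
    (hY : HasDerivAt Y (-((2 : ℝ) • c • Y t)) t) :
    HasDerivAt (fun s => radicand r (X s) (Y s)) (-4 * c * radicand r (X t) (Y t)) t := by
  refine (hasDerivAt_radicand hX hY).congr_deriv ?_
  simp only [inner_neg_right, inner_smul_right, real_inner_self_eq_norm_sq, radicand]
  ring

lemma projFactor_smul (ε r : ℝ) (x ξ : EuclideanSpace ℝ (Fin 2)) {c : ℝ} (hc : 0 < c) :
    projFactor ε r x (c • ξ) = c * projFactor ε r x ξ := by
  unfold projFactor
  rw [funkMetric_smul ε r x ξ hc.le, norm_smul, inner_smul_right, Real.norm_of_nonneg hc.le,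
    mul_pow, mul_pow]
  have : (1 + ε * r ^ 2) * ((1 + ε * ‖x‖ ^ 2) * (c ^ 2 * ‖ξ‖ ^ 2) -
      2 * ε * (c ^ 2 * inner ℝ x ξ ^ 2)) / (2 * (c * funkMetric ε r x ξ) * (1 + ε * ‖x‖ ^ 2) ^ 2) =
      c * ((1 + ε * r ^ 2) * ((1 + ε * ‖x‖ ^ 2) * ‖ξ‖ ^ 2 - 2 * ε * inner ℝ x ξ ^ 2) /
        (2 * funkMetric ε r x ξ * (1 + ε * ‖x‖ ^ 2) ^ 2)) := by
    generalize 1 + ε * ‖x‖ ^ 2 = E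
    field_simp
  rw [this]
  ring

/-- Along the line `s ↦ x + s ξ` a geodesic satisfies the first-order equation
`s' = F(x, ξ) / F(x + s ξ, ξ)`, since geodesics have constant `F`-speed. -/
lemma exists_geodesic (hε : ε = -1 ∨ ε = 0 ∨ ε = 1) (hr : 0 < r) (hr1 : ε ≠ 0 → r ≤ 1)
    (hx : x ∈ Metric.ball 0 r) (hξ : ξ ≠ 0) :
    ∃ (δ : ℝ) (γ : ℝ → EuclideanSpace ℝ (Fin 2)), 0 < δ ∧
      IsGeodesicOn (funkMetric ε r) (Metric.ball 0 r) (Ioo (-δ) δ) γ ∧ γ 0 = x ∧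
      deriv γ 0 = ξ := by
  set F₀ := funkMetric ε r x ξ with hF₀
  have hpos {y : EuclideanSpace ℝ (Fin 2)} (hy : y ∈ Metric.ball 0 r) :
      0 < funkMetric ε r y ξ := by
    obtain ⟨h1, h2, h3⟩ := pos_factors_of_mem_ball hε hr hr1 hy
    exact funkMetric_pos h1 h2 h3 hξ
  have hF₀pos : 0 < F₀ := hpos hx
  set h : ℝ → ℝ := fun s => F₀ / funkMetric ε r (x + s • ξ) ξ with hh
  have hsmooth : ContDiffAt ℝ 1 h 0 := by
    obtain ⟨h1, h2, h3⟩ := pos_factors_of_mem_ball hε hr hr1 hx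
    have hF : ContDiffAt ℝ ∞ (fun p : EuclideanSpace ℝ (Fin 2) × EuclideanSpace ℝ (Fin 2) =>
        funkMetric ε r p.1 p.2) (x + (0 : ℝ) • ξ, ξ) := by
      rw [zero_smul, add_zero]
      exact contDiffAt_funkMetric h1.ne' h2.ne' (radicand_pos h1 hξ)
    have hline : ContDiffAt ℝ ∞ (fun s : ℝ => (x + s • ξ, ξ)) 0 := by fun_prop
    refine (contDiffAt_const.div (hF.comp (0 : ℝ) hline) ?_).of_le (n := ∞)
      (by exact_mod_cast le_top)
    simpa using (hpos hx).ne'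
  obtain ⟨f, hf0, δ₁, hδ₁, hf⟩ :=
    hsmooth.exists_forall_mem_closedBall_exists_eq_forall_mem_Ioo_hasDerivAt₀ 0
  have hf0' : HasDerivAt f (h (f 0)) 0 := hf 0 (by simp [hδ₁])
  have hball : ∀ᶠ t in nhds (0 : ℝ), x + f t • ξ ∈ Metric.ball (0 : EuclideanSpace ℝ (Fin 2)) r := by
    have hc : ContinuousAt (fun t => x + f t • ξ) 0 := by
      have := hf0'.continuousAt
      fun_prop
    refine hc.eventually (Metric.isOpen_ball.mem_nhds ?_)
    simpa [hf0] using hx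
  obtain ⟨δ₂, hδ₂, hb⟩ := Metric.eventually_nhds_iff.1 hball
  set γ : ℝ → EuclideanSpace ℝ (Fin 2) := fun t => x + f t • ξ with hγ
  set δ := min δ₁ δ₂
  have hmem {t : ℝ} (ht : t ∈ Ioo (-δ) δ) : γ t ∈ Metric.ball 0 r := by
    refine hb ?_
    rw [Real.dist_eq, sub_zero]
    exact (abs_lt.2 ht).trans_le (min_le_right _ _)
  have hf' {t : ℝ} (ht : t ∈ Ioo (-δ) δ) : HasDerivAt f (h (f t)) t := by
    have : |t| < δ₁ := (abs_lt.2 ht).trans_le (min_le_left _ _)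
    exact hf t (by simpa using abs_lt.1 this)
  have hγ' {t : ℝ} (ht : t ∈ Ioo (-δ) δ) : HasDerivAt γ (h (f t) • ξ) t :=
    ((hf' ht).smul_const ξ).const_add x
  have hhpos {t : ℝ} (ht : t ∈ Ioo (-δ) δ) : 0 < h (f t) := div_pos hF₀pos (hpos (hmem ht))
  have hδ : 0 < δ := lt_min hδ₁ hδ₂
  refine ⟨δ, γ, hδ, fun t ht => ?_, by simp [hγ, hf0], ?_⟩
  · have hd := (hγ' ht).deriv
    have hne : h (f t) • ξ ≠ 0 := smul_ne_zero (hhpos ht).ne' hξ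
    refine ⟨hmem ht, by rwa [hd], ?_⟩
    have hev : deriv γ =ᶠ[nhds t] fun s => h (f s) • ξ := by
      filter_upwards [isOpen_Ioo.mem_nhds ht] with s hs using (hγ' hs).deriv
    refine HasDerivAt.congr_of_eventuallyEq ?_ hev
    obtain ⟨h1, h2, h3⟩ := pos_factors_of_mem_ball hε hr hr1 (hmem ht)
    have hFt := hpos (hmem ht)
    have hFd : HasDerivAt (fun s => funkMetric ε r (x + s • ξ) ξ)
        (2 * projFactor ε r (γ t) ξ * funkMetric ε r (γ t) ξ) (f t) := by
      rw [← funkDeriv_base_self h1 h2 h3 hξ]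
      exact hasDerivAt_funkMetric (hasDerivAt_line x ξ (f t)) (hasDerivAt_const (f t) ξ)
        h1.ne' h2.ne' (radicand_pos h1 hξ)
    have hhd : HasDerivAt h (-(2 * projFactor ε r (γ t) ξ * h (f t))) (f t) := by
      refine ((hasDerivAt_const (f t) F₀).div hFd hFt.ne').congr_deriv ?_
      simp only [hh, hγ]
      change 0 < funkMetric ε r (x + f t • ξ) ξ at hFt
      field_simp
      ring
    rw [hd, spray_funkMetric h1 h2 h3 hne, projFactor_smul _ _ _ _ (hhpos ht)]
    refine ((hhd.comp t (hf' ht)).smul_const ξ).congr_deriv ?_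
    rw [smul_smul, smul_smul, ← neg_smul]
    ring_nf
  · rw [(hγ' (by simp [hδ] : (0 : ℝ) ∈ Ioo (-δ) δ)).deriv, hf0]
    have : h 0 = 1 := by simp [hh, ← hF₀, hF₀pos.ne']
    rw [this, one_smul]

/-! ### The area of the indicatrix -/

/-- The area of the elliptic region `A u² + 2 B u v + C v² + 2 l u + 2 m v < 1`. -/
lemma volume_ellipse {A B C l m : ℝ} (hA : 0 < A) (hdet : 0 < A * C - B ^ 2) :
    MeasureTheory.volume {ξ : EuclideanSpace ℝ (Fin 2) | A * ξ 0 ^ 2 + 2 * B * (ξ 0 * ξ 1) +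
        C * ξ 1 ^ 2 + 2 * (l * ξ 0 + m * ξ 1) < 1} =
      ENNReal.ofReal ((1 + (C * l ^ 2 - 2 * B * l * m + A * m ^ 2) / (A * C - B ^ 2)) /
        √(A * C - B ^ 2)) *
      MeasureTheory.volume (Metric.ball (0 : EuclideanSpace ℝ (Fin 2)) 1) := by
  set d := A * C - B ^ 2 with hd
  set N := 1 + (C * l ^ 2 - 2 * B * l * m + A * m ^ 2) / d with hN
  have hNpos : 0 < N := by
    have h : 0 ≤ A * (C * l ^ 2 - 2 * B * l * m + A * m ^ 2) := by
      have : A * (C * l ^ 2 - 2 * B * l * m + A * m ^ 2) = d * l ^ 2 + (A * m - B * l) ^ 2 := by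
        rw [hd]; ring
      rw [this]; positivity
    have h' := nonneg_of_mul_nonneg_right h hA
    positivity
  -- The Cholesky factor of the quadratic part, normalised so that the image is the unit disc.
  set T : Matrix (Fin 2) (Fin 2) ℝ := !![√(A / N), √(A / N) * (B / A); 0, √(d / (A * N))]
  set z : EuclideanSpace ℝ (Fin 2) :=
    !₂[√(A / N) * (l / A), √(d / (A * N)) * ((A * m - B * l) / d)]
  have hdetT : (T.toLpLin 2 2).det = √d / N := by
    rw [LinearMap.det_toLpLin, Matrix.det_fin_two]
    have : √(A / N) * √(d / (A * N)) = √d / N := by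
      rw [← Real.sqrt_mul (by positivity), show A / N * (d / (A * N)) = d / N ^ 2 by field_simp,
        Real.sqrt_div hdet.le, Real.sqrt_sq hNpos.le]
    simpa [T] using this
  have hdetpos : 0 < √d / N := div_pos (Real.sqrt_pos.2 hdet) hNpos
  have hset : {ξ : EuclideanSpace ℝ (Fin 2) | A * ξ 0 ^ 2 + 2 * B * (ξ 0 * ξ 1) +
        C * ξ 1 ^ 2 + 2 * (l * ξ 0 + m * ξ 1) < 1} =
      (T.toLpLin 2 2) ⁻¹' ((fun y => y + z) ⁻¹' Metric.ball 0 1) := by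
    ext ξ
    have hnorm : ‖T.toLpLin 2 2 ξ + z‖ ^ 2 =
        (A * ξ 0 ^ 2 + 2 * B * (ξ 0 * ξ 1) + C * ξ 1 ^ 2 + 2 * (l * ξ 0 + m * ξ 1) + (N - 1)) /
          N := by
      have e0 : (T.toLpLin 2 2 ξ + z) 0 = √(A / N) * (ξ 0 + B / A * ξ 1 + l / A) := by
        simp [T, z, Matrix.mulVec, dotProduct, Fin.sum_univ_two]; ring
      have e1 : (T.toLpLin 2 2 ξ + z) 1 = √(d / (A * N)) * (ξ 1 + (A * m - B * l) / d) := by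
        simp [T, z, Matrix.mulVec, dotProduct, Fin.sum_univ_two]; ring
      rw [norm_sq_eq, e0, e1, mul_pow, mul_pow, Real.sq_sqrt (by positivity),
        Real.sq_sqrt (by positivity)]
      have hC : C = (d + B ^ 2) / A := by rw [hd]; field_simp; ring
      have hN1 : N - 1 = (C * l ^ 2 - 2 * B * l * m + A * m ^ 2) / d := by rw [hN]; ring
      rw [hN1, hC]
      clear_value d N
      field_simp
      ring
    rw [mem_ofPred_eq, mem_preimage, mem_preimage, mem_ball_zero_iff,
      ← sq_lt_one_iff₀ (norm_nonneg _), hnorm, div_lt_one hNpos]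
    constructor <;> intro h <;> linarith
  rw [hset, MeasureTheory.Measure.addHaar_preimage_linearMap _ (by rw [hdetT]; exact hdetpos.ne'),
    MeasureTheory.measure_preimage_add_right, hdetT, abs_of_pos (inv_pos.2 hdetpos), inv_div]

/-- Squaring `α < 1 - β` describes the indicatrix by a quadratic inequality; the sign condition
`β < 1` is automatic since `|β| ≤ α`. -/
lemma funkMetric_lt_one_iff (hD : 0 < r ^ 2 - ‖x‖ ^ 2)
    (hE : 0 < 1 + ε * ‖x‖ ^ 2) (hC : 0 < 1 - ε ^ 2 * r ^ 2 * ‖x‖ ^ 2) :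
    funkMetric ε r x ξ < 1 ↔ radicand r x ξ / (r ^ 2 - ‖x‖ ^ 2) ^ 2 -
      funkBeta ε r x ξ ^ 2 + 2 * funkBeta ε r x ξ < 1 := by
  have hα : funkMetric ε r x ξ = √(radicand r x ξ) / (r ^ 2 - ‖x‖ ^ 2) + funkBeta ε r x ξ := rfl
  set a := √(radicand r x ξ) / (r ^ 2 - ‖x‖ ^ 2) with ha
  set b := funkBeta ε r x ξ with hb
  have hW : 0 ≤ radicand r x ξ := by unfold radicand; positivity
  have ha0 : 0 ≤ a := by positivity
  have ha2 : a ^ 2 = radicand r x ξ / (r ^ 2 - ‖x‖ ^ 2) ^ 2 := by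
    rw [ha, div_pow, Real.sq_sqrt hW]
  have hba : b ^ 2 ≤ a ^ 2 := by
    rcases eq_or_ne ξ 0 with rfl | hξ
    · simp [hb, funkBeta]; positivity
    · have h := (sq_beta_lt_radicand hD hE hC hξ).le
      have hb' : b = (1 + ε * r ^ 2) * inner ℝ x ξ / (1 + ε * ‖x‖ ^ 2) / (r ^ 2 - ‖x‖ ^ 2) := by
        rw [hb, funkBeta]; field_simp
      rw [ha2, hb', div_pow]
      gcongr
  have hba' : |b| ≤ a := abs_le_of_sq_le_sq hba ha0
  rw [hα, ← ha2]
  constructor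
  · intro h
    nlinarith [mul_pos (show 0 < 1 - b - a by linarith) (show 0 < 1 - b + a by linarith)]
  · intro h
    by_contra! hcon
    have := le_of_abs_le hba'
    rcases le_total b 1 with h1 | h1
    · nlinarith
    · nlinarith

/-- The Busemann-Hausdorff density, squared to avoid fractional powers. -/
lemma busemannHausdorffDensity_funkMetric (hr : 0 < r) (hD : 0 < r ^ 2 - ‖x‖ ^ 2)
    (hE : 0 < 1 + ε * ‖x‖ ^ 2) (hC : 0 < 1 - ε ^ 2 * r ^ 2 * ‖x‖ ^ 2) :
    0 ≤ busemannHausdorffDensity (funkMetric ε r) x ∧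
    busemannHausdorffDensity (funkMetric ε r) x ^ 2 =
      (1 - ε ^ 2 * r ^ 2 * ‖x‖ ^ 2) ^ 3 / (r ^ 4 * (1 + ε * ‖x‖ ^ 2) ^ 6) := by
  refine ⟨by unfold busemannHausdorffDensity; positivity, ?_⟩
  set k := (1 + ε * r ^ 2) / ((r ^ 2 - ‖x‖ ^ 2) * (1 + ε * ‖x‖ ^ 2)) with hk
  set c := 1 / (r ^ 2 - ‖x‖ ^ 2) ^ 2 - k ^ 2 with hc
  set A := 1 / (r ^ 2 - ‖x‖ ^ 2) + c * x 0 ^ 2 with hAdef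
  set B := c * (x 0 * x 1) with hBdef
  set C := 1 / (r ^ 2 - ‖x‖ ^ 2) + c * x 1 ^ 2 with hCdef
  have hβ (η : EuclideanSpace ℝ (Fin 2)) : funkBeta ε r x η = k * inner ℝ x η := by
    rw [hk, funkBeta]; ring
  have hquad (η : EuclideanSpace ℝ (Fin 2)) :
      radicand r x η / (r ^ 2 - ‖x‖ ^ 2) ^ 2 - funkBeta ε r x η ^ 2 =
        A * η 0 ^ 2 + 2 * B * (η 0 * η 1) + C * η 1 ^ 2 := by
    have : radicand r x η / (r ^ 2 - ‖x‖ ^ 2) ^ 2 = ‖η‖ ^ 2 * (1 / (r ^ 2 - ‖x‖ ^ 2)) +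
        inner ℝ x η ^ 2 * (1 / (r ^ 2 - ‖x‖ ^ 2) ^ 2) := by
      unfold radicand; field_simp
    rw [this, hβ, norm_sq_eq η, inner_eq, hAdef, hBdef, hCdef, hc]
    ring
  have hset : {η | funkMetric ε r x η < 1} = {η : EuclideanSpace ℝ (Fin 2) |
      A * η 0 ^ 2 + 2 * B * (η 0 * η 1) + C * η 1 ^ 2 +
        2 * (k * x 0 * η 0 + k * x 1 * η 1) < 1} := by
    ext η
    rw [mem_ofPred_eq, mem_ofPred_eq, funkMetric_lt_one_iff hD hE hC, hquad, hβ, inner_eq]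
    ring_nf
  have hdet : A * C - B ^ 2 = (1 - ε ^ 2 * r ^ 2 * ‖x‖ ^ 2) /
      ((r ^ 2 - ‖x‖ ^ 2) ^ 2 * (1 + ε * ‖x‖ ^ 2) ^ 2) := by
    have : A * C - B ^ 2 = 1 / (r ^ 2 - ‖x‖ ^ 2) ^ 2 + c * ‖x‖ ^ 2 / (r ^ 2 - ‖x‖ ^ 2) := by
      rw [hAdef, hBdef, hCdef]
      generalize r ^ 2 - ‖x‖ ^ 2 = D
      rw [norm_sq_eq x]
      ring
    have hfrac (D E K : ℝ) (hD : D ≠ 0) (hE : E ≠ 0) :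
        1 / D ^ 2 + (1 / D ^ 2 - (K / (D * E)) ^ 2) * ‖x‖ ^ 2 / D =
          (D * E ^ 2 + (E ^ 2 - K ^ 2) * ‖x‖ ^ 2) / (D ^ 3 * E ^ 2) := by
      field_simp
    rw [this, hc, hk, hfrac _ _ _ hD.ne' hE.ne', div_eq_div_iff (by positivity) (by positivity)]
    ring
  have hdet0 : 0 < A * C - B ^ 2 := by rw [hdet]; positivity
  have hA : 0 < A := by
    have hξ : (EuclideanSpace.single 0 1 : EuclideanSpace ℝ (Fin 2)) ≠ 0 := by
      simp
    have h1 := sq_beta_lt_radicand hD hE hC hξ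
    have h2 := hquad (EuclideanSpace.single 0 1)
    have h3 : A = radicand r x (EuclideanSpace.single 0 1) / (r ^ 2 - ‖x‖ ^ 2) ^ 2 -
        funkBeta ε r x (EuclideanSpace.single 0 1) ^ 2 := by
      rw [h2]; simp
    have hb' : funkBeta ε r x (EuclideanSpace.single 0 1) = (1 + ε * r ^ 2) *
        inner ℝ x (EuclideanSpace.single 0 1) / (1 + ε * ‖x‖ ^ 2) / (r ^ 2 - ‖x‖ ^ 2) := by
      rw [funkBeta]; field_simp
    rw [h3, hb', div_pow, ← sub_div]
    exact div_pos (by linarith) (by positivity)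
  have hN : 1 + (C * (k * x 0) ^ 2 - 2 * B * (k * x 0) * (k * x 1) + A * (k * x 1) ^ 2) /
      (A * C - B ^ 2) = r ^ 2 * (1 + ε * ‖x‖ ^ 2) ^ 2 /
        ((r ^ 2 - ‖x‖ ^ 2) * (1 - ε ^ 2 * r ^ 2 * ‖x‖ ^ 2)) := by
    have : C * (k * x 0) ^ 2 - 2 * B * (k * x 0) * (k * x 1) + A * (k * x 1) ^ 2 =
        k ^ 2 * ‖x‖ ^ 2 / (r ^ 2 - ‖x‖ ^ 2) := by
      rw [hAdef, hBdef, hCdef, norm_sq_eq x]; ring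
    rw [this, hdet, hk]
    generalize ‖x‖ ^ 2 = ρ at *
    field_simp
    ring
  have hV : 0 < (MeasureTheory.volume
      (Metric.ball (0 : EuclideanSpace ℝ (Fin 2)) 1)).toReal :=
    ENNReal.toReal_pos (Metric.measure_ball_pos _ _ one_pos).ne' MeasureTheory.measure_ball_lt_top.ne
  rw [busemannHausdorffDensity, hset, volume_ellipse hA hdet0, hN, ENNReal.toReal_mul,
    ENNReal.toReal_ofReal (by positivity), div_mul_cancel_right₀ hV.ne', inv_pow, div_pow, Real.sq_sqrt hdet0.le,
    hdet]
  generalize r ^ 2 - ‖x‖ ^ 2 = D at *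
  generalize 1 + ε * ‖x‖ ^ 2 = E at *
  generalize 1 - ε ^ 2 * r ^ 2 * ‖x‖ ^ 2 = C' at *
  field_simp

/-! ### The distortion and the S-curvature -/

lemma distortion_funkMetric (hr : 0 < r) (hD : 0 < r ^ 2 - ‖x‖ ^ 2)
    (hE : 0 < 1 + ε * ‖x‖ ^ 2) (hC : 0 < 1 - ε ^ 2 * r ^ 2 * ‖x‖ ^ 2) (hξ : ξ ≠ 0) :
    distortion (funkMetric ε r) x ξ = 3 / 2 * (Real.log (funkMetric ε r x ξ) -
      Real.log (radicand r x ξ) / 2 + 2 * Real.log r + 2 * Real.log (1 + ε * ‖x‖ ^ 2) -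
      Real.log (1 - ε ^ 2 * r ^ 2 * ‖x‖ ^ 2)) := by
  have hF := funkMetric_pos hD hE hC hξ
  have hW := radicand_pos hD hξ
  have hS := Real.sqrt_pos.2 hW
  obtain ⟨h0, h2⟩ := busemannHausdorffDensity_funkMetric hr hD hE hC
  rw [distortion, det_fundamentalTensor hD hE hξ, ← Real.sqrt_sq h0, h2,
    ← Real.sqrt_div (by positivity), Real.log_sqrt (by positivity)]
  have : funkMetric ε r x ξ ^ 3 * r ^ 2 / √(radicand r x ξ) ^ 3 /
      ((1 - ε ^ 2 * r ^ 2 * ‖x‖ ^ 2) ^ 3 / (r ^ 4 * (1 + ε * ‖x‖ ^ 2) ^ 6)) =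
      (funkMetric ε r x ξ * r ^ 2 * (1 + ε * ‖x‖ ^ 2) ^ 2 /
        (√(radicand r x ξ) * (1 - ε ^ 2 * r ^ 2 * ‖x‖ ^ 2))) ^ 3 := by
    generalize 1 + ε * ‖x‖ ^ 2 = E at *
    generalize 1 - ε ^ 2 * r ^ 2 * ‖x‖ ^ 2 = C' at *
    field_simp
  rw [this, Real.log_pow, Real.log_div (by positivity) (by positivity),
    Real.log_mul (by positivity) (by positivity), Real.log_mul (by positivity) (by positivity),
    Real.log_mul (by positivity) (by positivity), Real.log_pow, Real.log_pow,
    Real.log_sqrt hW.le]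
  push_cast
  ring

lemma hasDerivAt_distortion_of_geodesic (hε : ε = -1 ∨ ε = 0 ∨ ε = 1) (hr : 0 < r)
    (hr1 : ε ≠ 0 → r ≤ 1) {γ : ℝ → EuclideanSpace ℝ (Fin 2)} {I : Set ℝ} (hI : IsOpen I)
    (hγ : IsGeodesicOn (funkMetric ε r) (Metric.ball 0 r) I γ) {t : ℝ} (ht : t ∈ I) :
    HasDerivAt (fun s => distortion (funkMetric ε r) (γ s) (deriv γ s))
      (3 / 2 * (2 * projFactor ε r (γ t) (deriv γ t) +
        4 * ε * inner ℝ (γ t) (deriv γ t) / (1 + ε * ‖γ t‖ ^ 2) +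
        2 * ε ^ 2 * r ^ 2 * inner ℝ (γ t) (deriv γ t) / (1 - ε ^ 2 * r ^ 2 * ‖γ t‖ ^ 2))) t := by
  have hev : (fun s => distortion (funkMetric ε r) (γ s) (deriv γ s)) =ᶠ[nhds t] fun s =>
      3 / 2 * (Real.log (funkMetric ε r (γ s) (deriv γ s)) -
      Real.log (radicand r (γ s) (deriv γ s)) / 2 + 2 * Real.log r +
      2 * Real.log (1 + ε * ‖γ s‖ ^ 2) - Real.log (1 - ε ^ 2 * r ^ 2 * ‖γ s‖ ^ 2)) := by
    filter_upwards [hI.mem_nhds ht] with s hs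
    obtain ⟨hb, hne, -⟩ := hγ s hs
    obtain ⟨h1, h2, h3⟩ := pos_factors_of_mem_ball hε hr hr1 hb
    exact distortion_funkMetric hr h1 h2 h3 hne
  refine HasDerivAt.congr_of_eventuallyEq ?_ hev
  obtain ⟨hb, hne, hacc⟩ := hγ t ht
  obtain ⟨hD, hE, hC⟩ := pos_factors_of_mem_ball hε hr hr1 hb
  have hX : HasDerivAt γ (deriv γ t) t := (differentiableAt_of_deriv_ne_zero hne).hasDerivAt
  rw [spray_funkMetric hD hE hC hne] at hacc
  have hF := funkMetric_pos hD hE hC hne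
  have hW := radicand_pos hD hne
  have dF := (hasDerivAt_funkMetric_of_geodesic hX hacc hD hE hC hne).log hF.ne'
  have dW := (hasDerivAt_radicand_of_geodesic (r := r) hX hacc).log hW.ne'
  have dE := ((hX.norm_sq.const_mul ε).const_add 1).log hE.ne'
  have dC := ((hX.norm_sq.const_mul (ε ^ 2 * r ^ 2)).const_sub 1).log hC.ne'
  refine ((((dF.sub (dW.div_const 2)).add_const (2 * Real.log r)).add (dE.const_mul 2)).sub
    dC).const_mul (3 / 2) |>.congr_deriv ?_
  rw [mul_div_cancel_right₀ _ hW.ne']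
  ring

/-- The derivative of the distortion in the form of the stated S-curvature; the summand without `F`
is a partial fraction decomposition. -/
lemma sCurvature_eq (hD : 0 < r ^ 2 - ‖x‖ ^ 2)
    (hE : 0 < 1 + ε * ‖x‖ ^ 2) (hC : 0 < 1 - ε ^ 2 * r ^ 2 * ‖x‖ ^ 2) (hξ : ξ ≠ 0) :
    3 / 2 * (2 * projFactor ε r x ξ + 4 * ε * inner ℝ x ξ / (1 + ε * ‖x‖ ^ 2) +
        2 * ε ^ 2 * r ^ 2 * inner ℝ x ξ / (1 - ε ^ 2 * r ^ 2 * ‖x‖ ^ 2)) =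
      3 * (1 + ε * r ^ 2) *
              ((1 + ε * ‖x‖ ^ 2) * ‖ξ‖ ^ 2 - 2 * ε * inner ℝ x ξ ^ 2) /
            (2 * funkMetric ε r x ξ * (r ^ 2 - ‖x‖ ^ 2) *
              (1 + ε * ‖x‖ ^ 2) ^ 2) +
          3 * inner ℝ x ξ * (1 + ε * r ^ 2) ^ 2 * (1 - ε * ‖x‖ ^ 2) /
            ((r ^ 2 - ‖x‖ ^ 2) * (1 - ε ^ 2 * r ^ 2 * ‖x‖ ^ 2) * (1 + ε * ‖x‖ ^ 2)) := by
  have hF := funkMetric_pos hD hE hC hξ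
  have key : (1 + ε * r ^ 2) ^ 2 * (1 - ε * ‖x‖ ^ 2) /
      ((r ^ 2 - ‖x‖ ^ 2) * (1 - ε ^ 2 * r ^ 2 * ‖x‖ ^ 2) * (1 + ε * ‖x‖ ^ 2)) =
      1 / (r ^ 2 - ‖x‖ ^ 2) + 2 * ε / (1 + ε * ‖x‖ ^ 2) +
        ε ^ 2 * r ^ 2 / (1 - ε ^ 2 * r ^ 2 * ‖x‖ ^ 2) := by
    rw [div_add_div _ _ hD.ne' hE.ne', div_add_div _ _ (mul_pos hD hE).ne' hC.ne',
      div_eq_div_iff (by positivity) (by positivity)]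
    ring
  rw [mul_assoc (3 * inner ℝ x ξ), mul_div_assoc (3 * inner ℝ x ξ), key, projFactor]
  generalize 1 + ε * ‖x‖ ^ 2 = E at *
  generalize 1 - ε ^ 2 * r ^ 2 * ‖x‖ ^ 2 = C' at *
  generalize r ^ 2 - ‖x‖ ^ 2 = D at *
  field_simp
  ring

end FunkFinsler

theorem theorem4p1 (ε r : ℝ) (hε : ε = -1 ∨ ε = 0 ∨ ε = 1) (hr : 0 < r)
    (hr1 : ε ≠ 0 → r ≤ 1) :
    FunkFinsler.IsFinslerOn (FunkFinsler.funkMetric ε r)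
      (Metric.ball (0 : EuclideanSpace ℝ (Fin 2)) r) ∧
    FunkFinsler.IsProjectivelyFlatOn (FunkFinsler.funkMetric ε r)
      (Metric.ball (0 : EuclideanSpace ℝ (Fin 2)) r) ∧
    ∀ x ∈ Metric.ball (0 : EuclideanSpace ℝ (Fin 2)) r,
      ∀ ξ : EuclideanSpace ℝ (Fin 2), ξ ≠ 0 →
      (∀ i : Fin 2,
        FunkFinsler.spray (FunkFinsler.funkMetric ε r) x ξ i =
          ξ i / (r ^ 2 - ‖x‖ ^ 2) *
            (inner ℝ x ξ +
              (1 + ε * r ^ 2) *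
                  ((1 + ε * ‖x‖ ^ 2) * ‖ξ‖ ^ 2 - 2 * ε * inner ℝ x ξ ^ 2) /
                (2 * FunkFinsler.funkMetric ε r x ξ * (1 + ε * ‖x‖ ^ 2) ^ 2))) ∧
      FunkFinsler.HasSCurvatureAt (FunkFinsler.funkMetric ε r)
        (Metric.ball (0 : EuclideanSpace ℝ (Fin 2)) r) x ξ
        (3 * (1 + ε * r ^ 2) *
              ((1 + ε * ‖x‖ ^ 2) * ‖ξ‖ ^ 2 - 2 * ε * inner ℝ x ξ ^ 2) /
            (2 * FunkFinsler.funkMetric ε r x ξ * (r ^ 2 - ‖x‖ ^ 2) *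
              (1 + ε * ‖x‖ ^ 2) ^ 2) +
          3 * inner ℝ x ξ * (1 + ε * r ^ 2) ^ 2 * (1 - ε * ‖x‖ ^ 2) /
            ((r ^ 2 - ‖x‖ ^ 2) * (1 - ε ^ 2 * r ^ 2 * ‖x‖ ^ 2) * (1 + ε * ‖x‖ ^ 2))) := by
  refine ⟨⟨Metric.isOpen_ball, fun x hx ξ => ?_, fun p hp => ?_,
    fun x _ ξ c hc => FunkFinsler.funkMetric_smul ε r x ξ hc.le, fun x hx ξ hξ => ?_⟩,
    fun I σ hI hI' hσ => ?_, fun x hx ξ hξ => ⟨fun i => ?_,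
      FunkFinsler.exists_geodesic hε hr hr1 hx hξ, fun δ γ hδ hγ hγ0 hγ0' => ?_⟩⟩
  · obtain ⟨hD, hE, hC⟩ := FunkFinsler.pos_factors_of_mem_ball hε hr hr1 hx
    rcases eq_or_ne ξ 0 with rfl | hξ
    · exact (FunkFinsler.funkMetric_zero ε r x).ge
    · exact (FunkFinsler.funkMetric_pos hD hE hC hξ).le
  · obtain ⟨hD, hE, -⟩ := FunkFinsler.pos_factors_of_mem_ball hε hr hr1 hp.1
    exact (FunkFinsler.contDiffAt_funkMetric hD.ne' hE.ne'
      (FunkFinsler.radicand_pos hD hp.2)).contDiffWithinAt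
  · obtain ⟨hD, hE, hC⟩ := FunkFinsler.pos_factors_of_mem_ball hε hr hr1 hx
    exact FunkFinsler.posDef_fundamentalTensor hD hE hC hξ
  · refine FunkFinsler.exists_straight_of_hasDerivAt_deriv hI hI' (fun t ht => (hσ t ht).2.1)
      (c := fun t => -(2 * FunkFinsler.projFactor ε r (σ t) (deriv σ t))) fun t ht => ?_
    obtain ⟨hb, hne, hacc⟩ := hσ t ht
    obtain ⟨hD, hE, hC⟩ := FunkFinsler.pos_factors_of_mem_ball hε hr hr1 hb
    rwa [FunkFinsler.spray_funkMetric hD hE hC hne, smul_smul, ← neg_smul] at hacc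
  · obtain ⟨hD, hE, hC⟩ := FunkFinsler.pos_factors_of_mem_ball hε hr hr1 hx
    rw [FunkFinsler.spray_funkMetric hD hE hC hξ, PiLp.smul_apply, smul_eq_mul,
      FunkFinsler.projFactor]
    ring
  · obtain ⟨hD, hE, hC⟩ := FunkFinsler.pos_factors_of_mem_ball hε hr hr1 hx
    have h := FunkFinsler.hasDerivAt_distortion_of_geodesic hε hr hr1 isOpen_Ioo hγ
      (show (0 : ℝ) ∈ Ioo (-δ) δ by simp [hδ])
    rw [hγ0, hγ0'] at h
    rwa [← FunkFinsler.sCurvature_eq hD hE hC hξ]
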